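/- Let $r > s \ge 1$ and $r \ge 3$, let $U \subset \mathbb{R}^n$ be open, and let $x : U \to \mathbb{R}^{n+1}$ be an injective $C^r$-immersion, with a continuous unit normal field $\xi : U \to \mathbb{R}^{n+1}$. Write $f_{/i} = \partial f/\partial u^i$ and $f_{/ij} = \partial^2 f/\partial u^i \partial u^j$. Suppose that the Gaussian curvature $K = \det(\langle \xi, x_{/ij}\rangle)/\det(\langle x_{/i}, x_{/j}\rangle)$ vanishes nowhere on $U$. Let $y : U \to \mathbb{R}^{n+1}$ be a relative $C^s$-normalization, i.e. a $C^s$-map such that at every point $y \notin \operatorname{span}(x_{/1},\dots,x_{/n})$ and $y_{/i} \in \operatorname{span}(x_{/1},\dots,x_{/n})$ for $i = 1,\dots,n$. Let $q = \langle \xi, y\rangle$ be its support function, let $X$ be the covector determined by $\langle X, x_{/i}\rangle = 0$ ($i = 1,\dots,n$) and $\langle X, y\rangle = 1$, and let $G_{ij} = \langle X, x_{/ij}\rangle$ be the relative metric, which is symmetric and nondegenerate (possibly indefinite). Let $\Delta^G f = G^{ij}\,(f_{/ij} - \Gamma^k_{ij} f_{/k})$ be its second Beltrami operator, where $\Gamma^k_{ij}$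 are the Christoffel symbols of $G$; it is applied to vector-valued functions componentwise. For maps $a, b : U \to \mathbb{R}^{n+1}$ let $\langle a, db\rangle$ denote the 1-form $\sum_i \langle a, b_{/i}\rangle\, du^i$. Then: (a) If $n = 2$, then $\langle \Delta^G x, d\xi\rangle + \langle \Delta^G \xi, dx\rangle = 0$ at every point of $U$, for every relative normalization $y$. (b) If $n \ne 2$ and $U$ is connected, then $\langle \Delta^G x, d\xi\rangle + \langle \Delta^G \xi, dx\rangle = 0$ at every point of $U$ if and only if $q$ is constant on $U$. (c) If $U$ is connected, then $\langle \Delta^G x, d\xi\rangle - \langle \Delta^G \xi, dx\rangle = 0$ at every point of $U$ if and only if $K$ is constant on $U$. -/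

import Mathlib

noncomputable section

namespace RelGeom

/-- The parameter space `ℝⁿ`. -/
abbrev Param (n : ℕ) := EuclideanSpace ℝ (Fin n)

/-- The ambient Euclidean space `ℝⁿ⁺¹`. -/
abbrev Ambient (n : ℕ) := EuclideanSpace ℝ (Fin (n + 1))

/-- The partial derivative `f_{/i} = ∂f/∂uⁱ`. -/
def pd {n : ℕ} {F : Type*} [NormedAddCommGroup F] [NormedSpace ℝ F]
    (i : Fin n) (f : Param n → F) (u : Param n) : F :=
  fderiv ℝ f u (EuclideanSpace.single i 1)

/-- The tangent vector space of the hypersurface `x` at the parameter value `u`. -/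
def tangentSpace {n : ℕ} (x : Param n → Ambient n) (u : Param n) : Submodule ℝ (Ambient n) :=
  Submodule.span ℝ (Set.range fun i : Fin n => pd i x u)

/-- `x : U → ℝⁿ⁺¹` is an injective immersion of class `C^r`. -/
structure IsHypersurface {n : ℕ} (r : WithTop ℕ∞) (U : Set (Param n))
    (x : Param n → Ambient n) : Prop where
  contDiffOn : ContDiffOn ℝ r x U
  injOn : Set.InjOn x U
  immersion : ∀ u ∈ U, LinearIndependent ℝ (fun i : Fin n => pd i x u)

/-- `ξ` is a Euclidean normalization of `x` on `U`: a continuous field of unit normal vectors. -/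
structure IsEuclideanNormalization {n : ℕ} (U : Set (Param n))
    (x ξ : Param n → Ambient n) : Prop where
  continuousOn : ContinuousOn ξ U
  norm_eq_one : ∀ u ∈ U, ‖ξ u‖ = 1
  normal : ∀ u ∈ U, ∀ i : Fin n, inner ℝ (ξ u) (pd i x u) = 0

/-- `y` is a relative `C^s`-normalization of `x` on `U`. -/
structure IsRelativeNormalization {n : ℕ} (s : WithTop ℕ∞) (U : Set (Param n))
    (x y : Param n → Ambient n) : Prop where
  contDiffOn : ContDiffOn ℝ s y U
  transversal : ∀ u ∈ U, y u ∉ tangentSpace x u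
  pd_mem : ∀ u ∈ U, ∀ i : Fin n, pd i y u ∈ tangentSpace x u

/-- The first fundamental form `g_{ij} = ⟨x_{/i}, x_{/j}⟩`. -/
def firstForm {n : ℕ} (x : Param n → Ambient n) (u : Param n) : Matrix (Fin n) (Fin n) ℝ :=
  Matrix.of fun i j => inner ℝ (pd i x u) (pd j x u)

/-- The second fundamental form `h_{ij} = ⟨ξ, x_{/ij}⟩`. -/
def secondForm {n : ℕ} (x ξ : Param n → Ambient n) (u : Param n) : Matrix (Fin n) (Fin n) ℝ :=
  Matrix.of fun i j => inner ℝ (ξ u) (pd j (pd i x) u)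

/-- The Gaussian curvature `K = det(h_{ij}) / det(g_{ij})`, the product of the principal
curvatures. -/
def gaussCurvature {n : ℕ} (x ξ : Param n → Ambient n) (u : Param n) : ℝ :=
  (secondForm x ξ u).det / (firstForm x u).det

/-- The support function `q = ⟨ξ, y⟩`. -/
def supportFunction {n : ℕ} (ξ y : Param n → Ambient n) (u : Param n) : ℝ :=
  inner ℝ (ξ u) (y u)

/-- The covector `X` of the tangent hyperplane: the vector determined by `⟨X, x_{/i}⟩ = 0` for
all `i` and `⟨X, y⟩ = 1`. For an immersion `x` and a transversal `y` exactly one vector has these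
properties. -/
def covector {n : ℕ} (x y : Param n → Ambient n) (u : Param n) : Ambient n :=
  Classical.epsilon fun X : Ambient n =>
    (∀ i : Fin n, inner ℝ X (pd i x u) = 0) ∧ inner ℝ X (y u) = 1

/-- The relative metric `G_{ij} = ⟨X, x_{/ij}⟩`. -/
def relMetric {n : ℕ} (x y : Param n → Ambient n) (u : Param n) : Matrix (Fin n) (Fin n) ℝ :=
  Matrix.of fun i j => inner ℝ (covector x y u) (pd j (pd i x) u)

/-- The Christoffel symbols `Γ^k_{ij}` of the Levi-Civita connection of a nondegenerate
symmetric form `G`. -/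
def christoffel {n : ℕ} (G : Param n → Matrix (Fin n) (Fin n) ℝ) (k i j : Fin n)
    (u : Param n) : ℝ :=
  (1 / 2) * ∑ m, (G u)⁻¹ k m *
    (pd i (fun v => G v j m) u + pd j (fun v => G v i m) u - pd m (fun v => G v i j) u)

/-- The second Beltrami operator (Laplace-Beltrami operator) of a nondegenerate symmetric form
`G`: `Δ^G f = G^{ij} ∇_j ∇_i f = G^{ij} (f_{/ij} - Γ^k_{ij} f_{/k})`. It is applied to
vector-valued functions as well (equivalently, component by component). -/
def beltrami {n : ℕ} {F : Type*} [NormedAddCommGroup F] [NormedSpace ℝ F]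
    (G : Param n → Matrix (Fin n) (Fin n) ℝ) (f : Param n → F) (u : Param n) : F :=
  ∑ i, ∑ j, (G u)⁻¹ i j • (pd j (pd i f) u - ∑ k, christoffel G k i j u • pd k f u)

/-- The 1-form `⟨a, db⟩`, sending a vector `v` at `u` to `⟨a(u), db_u(v)⟩`. -/
def pairDiff {n : ℕ} (a b : Param n → Ambient n) (u : Param n) : Param n →L[ℝ] ℝ :=
  (innerSL ℝ (a u)).comp (fderiv ℝ b u)

end RelGeom

end

/-! Write h for the second and g for the first fundamental form. Since `X = ξ/q`, the relative
metric is `G = h/q`. Differentiating `⟨ξ, x_{/i}⟩ = 0` once and twice expresses both 1-forms through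
h. On the k-th basis vector they are the contractions with `G^{ij}` of `⟨x_{/ij}, ξ_{/k}⟩ + Γ^m_{ij}
h_{km}` and `-h_{ki/j} - ⟨x_{/kj}, ξ_{/i}⟩ + Γ^m_{ij} h_{km}`. In `h_{ij/k} = ⟨x_{/ij}, ξ_{/k}⟩ +
⟨ξ, x_{/ijk}⟩` the last term is totally symmetric, so it cancels whenever two such identities are
compared.

Sum: lowering the index of Γ and inserting `h = qG`, all derivatives of G cancel. What remains is
`q_{/k} G_{ij} - q_{/i} G_{jk} - q_{/j} G_{ik}`, with trace `(n - 2) q_{/k}`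
(`pairDiff_add_pairDiff`). Hence dimension 2 is exceptional.

Difference: the Christoffel terms cancel, and `G^{ij} = q h^{ij}` leaves `q h^{ij} (h_{ij/k} +
2⟨x_{/kj}, ξ_{/i}⟩)`. By Jacobi's formula and Weingarten's `h^{ij} ξ_{/i} = -g^{ij} x_{/i}`, this is
`q K_{/k} / K` (`pairDiff_sub_pairDiff`).

As q and K never vanish, (b) and (c) reduce to a function with zero derivative being constant on a
connected open set. -/

open RelGeom Filter Topology

namespace RelGeom

/-! ### Partial derivatives and Jacobi's formula. -/

section Calculus

variable {n : ℕ} {F : Type*} [NormedAddCommGroup F] [NormedSpace ℝ F]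

theorem contDiffAt_pd {m k : WithTop ℕ∞} {f : Param n → F} {u : Param n}
    (hf : ContDiffAt ℝ k f u) (h : m + 1 ≤ k) (i : Fin n) : ContDiffAt ℝ m (pd i f) u :=
  (hf.fderiv_right h).clm_apply contDiffAt_const

theorem pd_comm {f : Param n → F} {u : Param n} (hf : ContDiffAt ℝ 2 f u) (i j : Fin n) :
    pd i (pd j f) u = pd j (pd i f) u := by
  have hd : DifferentiableAt ℝ (fderiv ℝ f) u :=
    (hf.fderiv_right (m := 1) (by norm_num)).differentiableAt one_ne_zero
  have key : ∀ a b : Fin n, pd a (pd b f) u =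
      fderiv ℝ (fderiv ℝ f) u (EuclideanSpace.single a 1) (EuclideanSpace.single b 1) := by
    intro a b
    change fderiv ℝ (fun v => fderiv ℝ f v (EuclideanSpace.single b 1)) u _ = _
    rw [fderiv_clm_apply hd (differentiableAt_const _)]
    simp
  rw [key, key]
  exact hf.isSymmSndFDerivAt (by simp) _ _

theorem pd_congr {f g : Param n → F} {u : Param n} (h : f =ᶠ[𝓝 u] g) (i : Fin n) :
    pd i f u = pd i g u := by
  unfold pd
  rw [h.fderiv_eq]

theorem pd_congr_on {U : Set (Param n)} (hU : IsOpen U) {f g : Param n → F}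
    (h : Set.EqOn f g U) {u : Param n} (hu : u ∈ U) (i : Fin n) : pd i f u = pd i g u :=
  pd_congr (h.eventuallyEq_of_mem (hU.mem_nhds hu)) i

theorem pd_const (c : F) (i : Fin n) (u : Param n) : pd i (fun _ => c) u = 0 := by
  simp [pd]

theorem pd_neg (f : Param n → F) (i : Fin n) (u : Param n) :
    pd i (fun v => -f v) u = -pd i f u := by
  simp [pd, fderiv_fun_neg]

theorem pd_mul {f g : Param n → ℝ} {u : Param n} (hf : DifferentiableAt ℝ f u)
    (hg : DifferentiableAt ℝ g u) (i : Fin n) :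
    pd i (fun v => f v * g v) u = pd i f u * g u + f u * pd i g u := by
  simp [pd, fderiv_fun_mul hf hg]
  ring

theorem pd_inner {E : Type*} [NormedAddCommGroup E] [InnerProductSpace ℝ E]
    {f g : Param n → E} {u : Param n} (hf : DifferentiableAt ℝ f u)
    (hg : DifferentiableAt ℝ g u) (i : Fin n) :
    pd i (fun v => inner ℝ (f v) (g v)) u = inner ℝ (pd i f u) (g u) + inner ℝ (f u) (pd i g u) := by
  unfold pd
  rw [fderiv_inner_apply ℝ hf hg]
  ring

theorem clm_eq_zero_iff {A : Param n →L[ℝ] F} :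
    A = 0 ↔ ∀ i, A (EuclideanSpace.single i 1) = 0 := by
  refine ⟨fun h i => by simp [h], fun h => ?_⟩
  have : (A : Param n →ₗ[ℝ] F) = 0 :=
    (EuclideanSpace.basisFun (Fin n) ℝ).toBasis.ext fun i => by simpa using h i
  ext v
  exact congrArg (fun B : Param n →ₗ[ℝ] F => B v) this

theorem fderiv_eq_zero_iff_pd {f : Param n → F} {u : Param n} :
    fderiv ℝ f u = 0 ↔ ∀ i, pd i f u = 0 :=
  clm_eq_zero_iff

theorem exists_eq_const_iff_pd_eq_zero {U : Set (Param n)} (hU : IsOpen U)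
    (hU' : IsPreconnected U) {f : Param n → ℝ} (hf : ∀ u ∈ U, DifferentiableAt ℝ f u) :
    (∃ c, ∀ u ∈ U, f u = c) ↔ ∀ u ∈ U, ∀ i, pd i f u = 0 := by
  constructor
  · rintro ⟨c, hc⟩ u hu i
    rw [pd_congr_on hU (g := fun _ => c) hc hu, pd_const]
  · intro h
    exact hU.exists_is_const_of_fderiv_eq_zero hU'
      (fun u hu => (hf u hu).differentiableWithinAt)
      (fun u hu => fderiv_eq_zero_iff_pd.2 (h u hu))

/-- Jacobi's formula: the determinant is multilinear in the rows, so its derivative is a sum of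
determinants with one row replaced, and Cramer's rule expands each of these by cofactors. -/
theorem hasFDerivAt_det {A : Param n → Matrix (Fin n) (Fin n) ℝ} {u : Param n}
    (hA : ∀ i j, DifferentiableAt ℝ (fun v => A v i j) u) :
    HasFDerivAt (fun v => (A v).det)
      (∑ i, ∑ j, (A u).adjugate j i • fderiv ℝ (fun v => A v i j) u) u := by
  let D : ContinuousMultilinearMap ℝ (fun _ : Fin n => Fin n → ℝ) ℝ :=
    { (Matrix.detRowAlternating (R := ℝ) (n := Fin n)).toMultilinearMap with
      cont := by
        change Continuous fun M : Fin n → Fin n → ℝ => (Matrix.of M).det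
        exact Continuous.matrix_det continuous_id }
  have h := HasFDerivAt.multilinear_comp (f := D) (g := fun i v => A v i) (x := u)
    (g' := fun i => fderiv ℝ (fun v => A v i) u)
    (fun i => (differentiableAt_pi.2 (hA i)).hasFDerivAt)
  refine h.congr_fderiv ?_
  ext w
  simp only [sum_apply, ContinuousLinearMap.comp_apply, smul_apply]
  refine Finset.sum_congr rfl fun i _ => ?_
  have e : ∀ j, fderiv ℝ (fun v => A v i) u w j = fderiv ℝ (fun v => A v i j) u w := by
    intro j
    rw [fderiv_apply (𝕜 := ℝ) (differentiableAt_pi.2 (hA i))]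
    rfl
  change Matrix.det (Function.update (A u) i (fderiv ℝ (fun v => A v i) u w)) = _
  have := Matrix.cramer_transpose_apply (A u) (fderiv ℝ (fun v => A v i) u w) i
  rw [show Function.update (A u) i (fderiv ℝ (fun v => A v i) u w) =
      Matrix.updateRow (A u) i (fderiv ℝ (fun v => A v i) u w) from rfl, ← this,
    Matrix.cramer_eq_adjugate_mulVec, ← Matrix.adjugate_transpose]
  simp [Matrix.mulVec, dotProduct, e, smul_eq_mul]

theorem pd_det {A : Param n → Matrix (Fin n) (Fin n) ℝ} {u : Param n}
    (hA : ∀ i j, DifferentiableAt ℝ (fun v => A v i j) u) (hdet : (A u).det ≠ 0) (k : Fin n) :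
    pd k (fun v => (A v).det) u =
      (A u).det * ∑ i, ∑ j, (A u)⁻¹ j i * pd k (fun v => A v i j) u := by
  have hadj : (A u).adjugate = (A u).det • (A u)⁻¹ := by
    rw [Matrix.inv_def, Ring.inverse_eq_inv', smul_smul, mul_inv_cancel₀ hdet, one_smul]
  unfold pd
  rw [(hasFDerivAt_det hA).fderiv, hadj]
  simp [Finset.mul_sum, mul_assoc]

end Calculus

/-! ### Index contractions with a nondegenerate matrix. -/

section Algebra

variable {ι : Type*} [Fintype ι] [DecidableEq ι]

/-- Lowers the upper index of a Christoffel symbol: `c` stands for the combination of first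
derivatives of the metric. -/
theorem sum_christoffel_mul {G : Matrix ι ι ℝ} (hG : G.det ≠ 0) (c : ι → ℝ) (k : ι) :
    ∑ m, (1 / 2 * ∑ l, G⁻¹ m l * c l) * G k m = 1 / 2 * c k := by
  have h : G.mulVec (G⁻¹.mulVec c) = c := by
    rw [Matrix.mulVec_mulVec, Matrix.mul_nonsing_inv _ (isUnit_iff_ne_zero.2 hG),
      Matrix.one_mulVec]
  have := congrFun h k
  simp only [Matrix.mulVec, dotProduct] at this
  rw [← this, Finset.mul_sum]
  exact Finset.sum_congr rfl fun m _ => by ring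

/-- Source of the factor `n - 2`: the first term contains the trace of the identity, and each of the
other two merely contracts an index and gives `c k`. -/
theorem sum_inv_mul_trace_part {G : Matrix ι ι ℝ} (hG : G.det ≠ 0) (hs : G.IsSymm)
    (c : ι → ℝ) (k : ι) :
    ∑ i, ∑ j, G⁻¹ i j * (c k * G i j - c i * G j k - c j * G i k) =
      (Fintype.card ι - 2) * c k := by
  have h1 : G⁻¹ * G = 1 := Matrix.nonsing_inv_mul _ (isUnit_iff_ne_zero.2 hG)
  have hsi : ∀ i j, G⁻¹ i j = G⁻¹ j i := fun i j => by
    have := hs.inv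
    exact (this.apply i j).symm
  have e : ∀ i k, ∑ j, G⁻¹ i j * G j k = if i = k then 1 else 0 := fun i k => by
    rw [← Matrix.mul_apply, h1, Matrix.one_apply]
  have t1 : ∑ i, ∑ j, G⁻¹ i j * (c k * G i j) = Fintype.card ι * c k := by
    have : ∀ i, ∑ j, G⁻¹ i j * (c k * G i j) = c k := fun i => by
      calc _ = c k * ∑ j, G⁻¹ i j * G j i := by
            rw [Finset.mul_sum]
            exact Finset.sum_congr rfl fun j _ => by rw [hs.apply j i]; ring
        _ = c k := by simp [e]
    simp [this]
  have t2 : ∑ i, ∑ j, G⁻¹ i j * (c i * G j k) = c k := by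
    have : ∀ i, ∑ j, G⁻¹ i j * (c i * G j k) = c i * if i = k then 1 else 0 := fun i => by
      rw [← e, Finset.mul_sum]
      exact Finset.sum_congr rfl fun j _ => by ring
    simp [this]
  have t3 : ∑ i, ∑ j, G⁻¹ i j * (c j * G i k) = c k := by
    rw [Finset.sum_comm, ← t2]
    exact Finset.sum_congr rfl fun i _ => Finset.sum_congr rfl fun j _ => by rw [hsi]
  simp only [mul_sub, Finset.sum_sub_distrib]
  rw [t1, t2, t3]
  ring

end Algebra

end RelGeom

namespace RelGeom

/-! ### The tangent hyperplane and its normal line. -/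

section LinearAlgebra

variable {n : ℕ} {v : Fin n → Ambient n} {e : Ambient n}

theorem span_range_eq_orthogonal (hv : LinearIndependent ℝ v) (he : ‖e‖ = 1)
    (hev : ∀ i, inner ℝ e (v i) = 0) :
    Submodule.span ℝ (Set.range v) = (ℝ ∙ e)ᗮ := by
  have he0 : e ≠ 0 := by
    rintro rfl
    simp at he
  have : Fact (Module.finrank ℝ (Ambient n) = n + 1) := ⟨by simp⟩
  apply Submodule.eq_of_le_of_finrank_eq
  · rw [Submodule.span_le]
    rintro _ ⟨i, rfl⟩
    exact Submodule.mem_orthogonal_singleton_iff_inner_right.2 (hev i)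
  · rw [Submodule.finrank_orthogonal_span_singleton (n := n) he0, finrank_span_eq_card hv,
      Fintype.card_fin]

/-- The difference of the two sides is orthogonal to `e`, hence lies in the span of `v`; it is also
orthogonal to that span, so it vanishes. -/
theorem eq_inner_smul_of_orthogonal (hv : LinearIndependent ℝ v) (he : ‖e‖ = 1)
    (hev : ∀ i, inner ℝ e (v i) = 0) {N : Ambient n} (hN : ∀ i, inner ℝ N (v i) = 0) :
    N = (inner ℝ e N : ℝ) • e := by
  have hee : (inner ℝ e e : ℝ) = 1 := by simp [he]
  have hmem : N - (inner ℝ e N : ℝ) • e ∈ Submodule.span ℝ (Set.range v) := by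
    rw [span_range_eq_orthogonal hv he hev, Submodule.mem_orthogonal_singleton_iff_inner_right,
      inner_sub_right, inner_smul_right, hee]
    ring
  have hperp : ∀ w ∈ Submodule.span ℝ (Set.range v),
      inner ℝ (N - (inner ℝ e N : ℝ) • e) w = 0 := by
    intro w hw
    induction hw using Submodule.span_induction with
    | mem w hw =>
      obtain ⟨i, rfl⟩ := hw
      rw [inner_sub_left, inner_smul_left, hN, hev]
      simp
    | zero => simp
    | add a b _ _ ha hb => rw [inner_add_right, ha, hb, add_zero]
    | smul c a _ ha => rw [inner_smul_right, ha, mul_zero]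
  exact sub_eq_zero.1 (inner_self_eq_zero.1 (hperp _ hmem))

end LinearAlgebra

/-! ### Smoothness of the unit normal field. -/

section Normal

variable {n : ℕ}

/-- The linear map pairing a vector with the tangent vectors `v i` and with `w`. -/
noncomputable def pairingMap (v : Fin n → Ambient n) (w : Ambient n) : Ambient n →L[ℝ] (Fin n → ℝ) × ℝ :=
  (ContinuousLinearMap.pi fun i => innerSL ℝ (v i)).prod (innerSL ℝ w)

theorem pairingMap_apply (v : Fin n → Ambient n) (w N : Ambient n) :
    pairingMap v w N = (fun i => inner ℝ (v i) N, inner ℝ w N) := rfl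

theorem exists_equiv_eq_pairingMap {v : Fin n → Ambient n} {w : Ambient n}
    (hv : LinearIndependent ℝ v) (hw : ‖w‖ = 1) (hwv : ∀ i, inner ℝ w (v i) = 0) :
    ∃ A : Ambient n ≃L[ℝ] (Fin n → ℝ) × ℝ, (A : Ambient n →L[ℝ] _) = pairingMap v w := by
  have hinj : Function.Injective (pairingMap v w : Ambient n →ₗ[ℝ] (Fin n → ℝ) × ℝ) := by
    rw [injective_iff_map_eq_zero]
    intro N hN
    change pairingMap v w N = 0 at hN
    rw [pairingMap_apply, Prod.mk_eq_zero] at hN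
    rw [eq_inner_smul_of_orthogonal hv hw hwv (N := N) fun i => by
      rw [real_inner_comm]; exact congrFun hN.1 i, hN.2, zero_smul]
  let A := LinearEquiv.ofInjectiveOfFinrankEq _ hinj (by simp)
  exact ⟨A.toContinuousLinearEquiv, by ext1 N; rfl⟩

/-- Only continuity of `ξ` is given. A smooth normal field comes from solving a linear system with
smooth coefficients; normalizing it recovers `ξ`, continuity fixing the sign. -/
theorem contDiffAt_normal {k : WithTop ℕ∞} {U : Set (Param n)} (hU : IsOpen U)
    {x ξ : Param n → Ambient n} (hξ : IsEuclideanNormalization U x ξ)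
    (hli : ∀ u ∈ U, LinearIndependent ℝ (fun i : Fin n => pd i x u))
    {u : Param n} (hu : u ∈ U) (hx : ∀ i, ContDiffOn ℝ k (pd i x) U) :
    ContDiffAt ℝ k ξ u := by
  obtain ⟨A, hA⟩ := exists_equiv_eq_pairingMap (hli u hu) (hξ.norm_eq_one u hu) (hξ.normal u hu)
  -- The last covector is frozen at `ξ u`, so that `B` depends on `v` only through the tangent
  -- vectors.
  set B : Param n → Ambient n →L[ℝ] (Fin n → ℝ) × ℝ :=
    fun v => pairingMap (fun i => pd i x v) (ξ u) with hB
  have hBu : B u = A := hA.symm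
  have hBd : ContDiffAt ℝ k B u := by
    refine ContDiffOn.contDiffAt (s := U) (contDiffOn_clm_apply.2 fun N => ?_) (hU.mem_nhds hu)
    exact (contDiffOn_pi.2 fun i => (hx i).inner ℝ contDiffOn_const).prodMk contDiffOn_const
  have hNd : ContDiffAt ℝ k (fun v => (B v).inverse (0, 1)) u := by
    refine ContDiffAt.clm_apply ?_ contDiffAt_const
    exact ContDiffAt.comp u (by rw [hBu]; exact contDiffAt_map_inverse A) hBd
  set N := fun v => (B v).inverse (0, 1) with hNdef
  have hNu : N u ≠ 0 := by
    intro h0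
    have : A (N u) = (0, 1) := by
      rw [hNdef]
      simp only
      rw [hBu, ContinuousLinearMap.inverse_equiv]
      exact A.apply_symm_apply _
    rw [h0, map_zero, Prod.ext_iff] at this
    simp at this
  refine ContDiffAt.congr_of_eventuallyEq (f := fun v => ‖N v‖⁻¹ • N v)
    (((hNd.norm ℝ hNu).inv (norm_ne_zero_iff.2 hNu)).smul hNd) ?_
  have hinv : ∀ᶠ v in 𝓝 u, (B v).IsInvertible :=
    hBd.continuousAt.eventually_mem (by
      rw [hBu]
      exact ContinuousLinearEquiv.nhds A)
  -- This excludes `N v` pointing along `-ξ v`.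
  have hpos : ∀ᶠ v in 𝓝 u, 0 < (inner ℝ (ξ u) (ξ v) : ℝ) := by
    have hc : ContinuousAt (fun v => (inner ℝ (ξ u) (ξ v) : ℝ)) u :=
      continuousAt_const.inner (hξ.continuousOn.continuousAt (hU.mem_nhds hu))
    exact hc.eventually (lt_mem_nhds (by simp [hξ.norm_eq_one u hu]))
  filter_upwards [hinv, hpos, hU.mem_nhds hu] with v hv hvpos hvU
  have hBN : B v (N v) = (0, 1) := hv.self_apply_inverse _
  rw [hB] at hBN
  simp only [pairingMap_apply, Prod.mk.injEq] at hBN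
  have hN := eq_inner_smul_of_orthogonal (hli v hvU) (hξ.norm_eq_one v hvU) (hξ.normal v hvU)
    (N := N v) fun i => by rw [real_inner_comm]; exact congrFun hBN.1 i
  set c : ℝ := inner ℝ (ξ v) (N v)
  have hc : c * inner ℝ (ξ u) (ξ v) = 1 := by
    rw [← hBN.2, hN, inner_smul_right]
  have hcpos : 0 < c := pos_of_mul_pos_left (by rw [hc]; exact one_pos) hvpos.le
  rw [hN, norm_smul, hξ.norm_eq_one v hvU, Real.norm_of_nonneg hcpos.le, mul_one, smul_smul,
    inv_mul_cancel₀ hcpos.ne', one_smul]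

end Normal

/-! ### The covector and the relative metric in Euclidean terms. -/

section RelativeNormalization

variable {n : ℕ} {x ξ y : Param n → Ambient n} {u : Param n}

theorem supportFunction_ne_zero (hli : LinearIndependent ℝ (fun i : Fin n => pd i x u))
    (h1 : ‖ξ u‖ = 1) (hp : ∀ i : Fin n, inner ℝ (ξ u) (pd i x u) = 0)
    (hy : y u ∉ tangentSpace x u) : supportFunction ξ y u ≠ 0 := by
  intro h
  refine hy ?_
  rw [tangentSpace, span_range_eq_orthogonal hli h1 hp]
  exact Submodule.mem_orthogonal_singleton_iff_inner_right.2 h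

theorem covector_eq (hli : LinearIndependent ℝ (fun i : Fin n => pd i x u))
    (h1 : ‖ξ u‖ = 1) (hp : ∀ i : Fin n, inner ℝ (ξ u) (pd i x u) = 0)
    (hy : y u ∉ tangentSpace x u) :
    covector x y u = (supportFunction ξ y u)⁻¹ • ξ u := by
  have hq := supportFunction_ne_zero hli h1 hp hy
  have hspec : (∀ i : Fin n, inner ℝ (covector x y u) (pd i x u) = 0) ∧
      inner ℝ (covector x y u) (y u) = 1 := by
    refine Classical.epsilon_spec (p := fun X : Ambient n =>
      (∀ i : Fin n, inner ℝ X (pd i x u) = 0) ∧ inner ℝ X (y u) = 1)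
      ⟨(supportFunction ξ y u)⁻¹ • ξ u, fun i => ?_, ?_⟩
    · rw [real_inner_smul_left, hp, mul_zero]
    · rw [real_inner_smul_left]
      exact inv_mul_cancel₀ hq
  have hX := eq_inner_smul_of_orthogonal hli h1 hp hspec.1
  have h2 := hspec.2
  rw [hX, real_inner_smul_left] at h2
  rw [hX, eq_inv_of_mul_eq_one_left h2]
  rfl

theorem relMetric_eq (hli : LinearIndependent ℝ (fun i : Fin n => pd i x u))
    (h1 : ‖ξ u‖ = 1) (hp : ∀ i : Fin n, inner ℝ (ξ u) (pd i x u) = 0)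
    (hy : y u ∉ tangentSpace x u) :
    relMetric x y u = (supportFunction ξ y u)⁻¹ • secondForm x ξ u := by
  ext i j
  simp [relMetric, secondForm, covector_eq hli h1 hp hy, real_inner_smul_left]

end RelativeNormalization

end RelGeom

namespace RelGeom

/-! ### Weingarten equations, derivatives of h, and the derivative of K. -/

section Structure

variable {n : ℕ} {U : Set (Param n)} {x ξ y : Param n → Ambient n} {u : Param n}

theorem contDiffOn_pd {m k : WithTop ℕ∞} (hU : IsOpen U) (hx : ContDiffOn ℝ k x U)
    (h : m + 1 ≤ k) (i : Fin n) : ContDiffOn ℝ m (pd i x) U := fun _ hv =>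
  (contDiffAt_pd (hx.contDiffAt (hU.mem_nhds hv)) h i).contDiffWithinAt

theorem IsEuclideanNormalization.contDiffOn (hU : IsOpen U) (hx : IsHypersurface 3 U x)
    (hξ : IsEuclideanNormalization U x ξ) : ContDiffOn ℝ 2 ξ U := fun _ hv =>
  (contDiffAt_normal hU hξ hx.immersion hv fun i =>
    contDiffOn_pd hU hx.contDiffOn (by norm_num) i).contDiffWithinAt

theorem secondForm_isSymm (hU : IsOpen U) (hx : IsHypersurface 3 U x) (hu : u ∈ U) :
    (secondForm x ξ u).IsSymm := by
  ext i j
  have h : ContDiffAt ℝ 2 x u :=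
    (hx.contDiffOn.contDiffAt (hU.mem_nhds hu)).of_le (by norm_num)
  simp [secondForm, pd_comm h i j]

/-- Differentiate `⟨ξ, x_{/i}⟩ = 0`. -/
theorem inner_pd_pd (hU : IsOpen U) (hx : IsHypersurface 3 U x)
    (hξ : IsEuclideanNormalization U x ξ) (hu : u ∈ U) (i k : Fin n) :
    inner ℝ (pd k ξ u) (pd i x u) = -secondForm x ξ u i k := by
  have hd1 : DifferentiableAt ℝ ξ u :=
    ((hξ.contDiffOn hU hx).contDiffAt (hU.mem_nhds hu)).differentiableAt two_ne_zero
  have hd2 : DifferentiableAt ℝ (pd i x) u :=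
    ((contDiffOn_pd (m := 2) hU hx.contDiffOn (by norm_num) i).contDiffAt
      (hU.mem_nhds hu)).differentiableAt two_ne_zero
  have h := pd_inner hd1 hd2 k
  rw [pd_congr_on hU (g := fun _ => (0 : ℝ)) (fun v hv => hξ.normal v hv i) hu, pd_const] at h
  change _ = -inner ℝ (ξ u) (pd k (pd i x) u)
  linarith

theorem differentiableAt_pd_pd (hU : IsOpen U) (hx : IsHypersurface 3 U x) (hu : u ∈ U)
    (i j : Fin n) : DifferentiableAt ℝ (pd j (pd i x)) u :=
  ((contDiffOn_pd (m := 1) hU (contDiffOn_pd (m := 2) hU hx.contDiffOn (by norm_num) i)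
    (by norm_num) j).contDiffAt (hU.mem_nhds hu)).differentiableAt one_ne_zero

theorem differentiableAt_secondForm (hU : IsOpen U) (hx : IsHypersurface 3 U x)
    (hξ : IsEuclideanNormalization U x ξ) (hu : u ∈ U) (i j : Fin n) :
    DifferentiableAt ℝ (fun v => secondForm x ξ v i j) u :=
  DifferentiableAt.inner ℝ
    (((hξ.contDiffOn hU hx).contDiffAt (hU.mem_nhds hu)).differentiableAt two_ne_zero)
    (differentiableAt_pd_pd hU hx hu i j)

theorem pd_secondForm (hU : IsOpen U) (hx : IsHypersurface 3 U x)
    (hξ : IsEuclideanNormalization U x ξ) (hu : u ∈ U) (i j k : Fin n) :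
    pd k (fun v => secondForm x ξ v i j) u =
      inner ℝ (pd j (pd i x) u) (pd k ξ u) + inner ℝ (ξ u) (pd k (pd j (pd i x)) u) := by
  rw [real_inner_comm]
  exact pd_inner
    (((hξ.contDiffOn hU hx).contDiffAt (hU.mem_nhds hu)).differentiableAt two_ne_zero)
    (differentiableAt_pd_pd hU hx hu i j) k

theorem pd_pd_comm (hU : IsOpen U) (hx : IsHypersurface 3 U x) (hu : u ∈ U) (i j : Fin n) :
    pd i (pd j x) u = pd j (pd i x) u :=
  pd_comm ((hx.contDiffOn.contDiffAt (hU.mem_nhds hu)).of_le (by norm_num)) i j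

theorem pd_pd_pd_comm_left (hU : IsOpen U) (hx : IsHypersurface 3 U x) (hu : u ∈ U)
    (i j k : Fin n) : pd i (pd j (pd k x)) u = pd j (pd i (pd k x)) u :=
  pd_comm ((contDiffOn_pd (m := 2) hU hx.contDiffOn (by norm_num) k).contDiffAt
    (hU.mem_nhds hu)) i j

theorem pd_pd_pd_comm_right (hU : IsOpen U) (hx : IsHypersurface 3 U x) (hu : u ∈ U)
    (i j k : Fin n) : pd i (pd j (pd k x)) u = pd i (pd k (pd j x)) u :=
  pd_congr_on hU (fun _ hv => pd_pd_comm hU hx hv j k) hu i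

theorem inner_pd_pd_normal (hU : IsOpen U) (hx : IsHypersurface 3 U x)
    (hξ : IsEuclideanNormalization U x ξ) (hu : u ∈ U) (i j k : Fin n) :
    inner ℝ (pd j (pd i ξ) u) (pd k x u) =
      -pd j (fun v => secondForm x ξ v k i) u - inner ℝ (pd j (pd k x) u) (pd i ξ u) := by
  have hd1 : DifferentiableAt ℝ (pd i ξ) u :=
    ((contDiffOn_pd (m := 1) hU (hξ.contDiffOn hU hx) (by norm_num) i).contDiffAt
      (hU.mem_nhds hu)).differentiableAt one_ne_zero
  have hd2 : DifferentiableAt ℝ (pd k x) u :=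
    ((contDiffOn_pd (m := 2) hU hx.contDiffOn (by norm_num) k).contDiffAt
      (hU.mem_nhds hu)).differentiableAt two_ne_zero
  have h := pd_inner hd1 hd2 j
  rw [pd_congr_on hU (fun v hv => inner_pd_pd hU hx hξ hv k i) hu, pd_neg] at h
  rw [real_inner_comm (pd j (pd k x) u)] at h
  linarith

/-- The Weingarten equation, contracted with the inverse of the second fundamental form. -/
theorem sum_inv_secondForm_mul_inner (hU : IsOpen U) (hx : IsHypersurface 3 U x)
    (hξ : IsEuclideanNormalization U x ξ) (hu : u ∈ U) (hH : (secondForm x ξ u).det ≠ 0)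
    (hg : (firstForm x u).det ≠ 0) (w : Fin n → Ambient n) :
    ∑ i, ∑ j, (secondForm x ξ u)⁻¹ j i * inner ℝ (w j) (pd i ξ u) =
      -∑ i, ∑ j, (firstForm x u)⁻¹ j i * inner ℝ (w j) (pd i x u) := by
  set H := secondForm x ξ u with hHdef
  set g := firstForm x u with hgdef
  have hd1 : DifferentiableAt ℝ ξ u :=
    ((hξ.contDiffOn hU hx).contDiffAt (hU.mem_nhds hu)).differentiableAt two_ne_zero
  have hmem : ∀ i, pd i ξ u ∈ Submodule.span ℝ (Set.range fun m : Fin n => pd m x u) := by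
    intro i
    rw [span_range_eq_orthogonal (hx.immersion u hu) (hξ.norm_eq_one u hu) (hξ.normal u hu),
      Submodule.mem_orthogonal_singleton_iff_inner_right]
    have h := pd_inner hd1 hd1 i
    rw [pd_congr_on hU (g := fun _ => (1 : ℝ)) (fun v hv => by simp [hξ.norm_eq_one v hv]) hu,
      pd_const, real_inner_comm (ξ u)] at h
    linarith
  choose B hB using fun i => (Submodule.mem_span_range_iff_exists_fun ℝ).1 (hmem i)
  -- `B` is the matrix of the Weingarten map, `ξ_{/i} = B_i^m x_{/m}`; pairing with `x_{/l}` gives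
  -- this identity.
  have hBg : (Matrix.of B) * g = -H := by
    ext i l
    have h := inner_pd_pd hU hx hξ hu l i
    rw [← hB i, sum_inner] at h
    have hs := (secondForm_isSymm (ξ := ξ) hU hx hu).apply i l
    rw [Matrix.mul_apply, Matrix.neg_apply, hHdef, ← hs, ← h]
    exact Finset.sum_congr rfl fun m _ => by
      rw [real_inner_smul_left]
      rfl
  have hHB : H⁻¹ * Matrix.of B = -g⁻¹ := by
    have h1 : H⁻¹ * (Matrix.of B * g) * g⁻¹ = -g⁻¹ := by
      rw [hBg, Matrix.mul_neg, Matrix.nonsing_inv_mul _ (isUnit_iff_ne_zero.2 hH)]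
      simp
    rwa [Matrix.mul_assoc, Matrix.mul_assoc, Matrix.mul_nonsing_inv _ (isUnit_iff_ne_zero.2 hg),
      Matrix.mul_one] at h1
  rw [Finset.sum_comm, Finset.sum_comm (f := fun i j => g⁻¹ j i * _), ← Finset.sum_neg_distrib]
  refine Finset.sum_congr rfl fun j _ => ?_
  have e : ∀ m, ∑ i, H⁻¹ j i * B i m = -g⁻¹ j m := fun m => by
    have := congrFun (congrFun hHB j) m
    rwa [Matrix.mul_apply] at this
  calc ∑ i, H⁻¹ j i * inner ℝ (w j) (pd i ξ u)
      = ∑ i, ∑ m, H⁻¹ j i * B i m * inner ℝ (w j) (pd m x u) := by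
        refine Finset.sum_congr rfl fun i _ => ?_
        rw [← hB i, inner_sum, Finset.mul_sum]
        exact Finset.sum_congr rfl fun m _ => by rw [real_inner_smul_right, mul_assoc]
    _ = ∑ m, (∑ i, H⁻¹ j i * B i m) * inner ℝ (w j) (pd m x u) := by
        rw [Finset.sum_comm]
        exact Finset.sum_congr rfl fun m _ => by rw [Finset.sum_mul]
    _ = -∑ m, g⁻¹ j m * inner ℝ (w j) (pd m x u) := by
        rw [← Finset.sum_neg_distrib]
        exact Finset.sum_congr rfl fun m _ => by rw [e, neg_mul]

theorem det_firstForm_ne_zero (hli : LinearIndependent ℝ fun i : Fin n => pd i x u) :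
    (firstForm x u).det ≠ 0 :=
  (Matrix.posDef_gram_of_linearIndependent (𝕜 := ℝ) hli).det_pos.ne'

theorem firstForm_isSymm : (firstForm x u).IsSymm := by
  ext i j
  exact real_inner_comm (pd i x u) (pd j x u)

theorem pd_firstForm (hU : IsOpen U) (hx : IsHypersurface 3 U x) (hu : u ∈ U) (i j k : Fin n) :
    DifferentiableAt ℝ (fun v => firstForm x v i j) u ∧
    pd k (fun v => firstForm x v i j) u =
      inner ℝ (pd k (pd i x) u) (pd j x u) + inner ℝ (pd k (pd j x) u) (pd i x u) := by
  have hd : ∀ l, DifferentiableAt ℝ (pd l x) u := fun l =>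
    ((contDiffOn_pd (m := 2) hU hx.contDiffOn (by norm_num) l).contDiffAt
      (hU.mem_nhds hu)).differentiableAt two_ne_zero
  refine ⟨(hd i).inner ℝ (hd j), ?_⟩
  rw [real_inner_comm (pd i x u)]
  exact pd_inner (hd i) (hd j) k

theorem differentiableAt_gaussCurvature (hU : IsOpen U) (hx : IsHypersurface 3 U x)
    (hξ : IsEuclideanNormalization U x ξ) (hu : u ∈ U) :
    DifferentiableAt ℝ (gaussCurvature x ξ) u := by
  have h1 := (hasFDerivAt_det fun i j =>
    differentiableAt_secondForm hU hx hξ hu i j).differentiableAt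
  have h2 := (hasFDerivAt_det fun i j => (pd_firstForm hU hx hu i j i).1).differentiableAt
  have h : gaussCurvature x ξ = fun v => (secondForm x ξ v).det * ((firstForm x v).det)⁻¹ :=
    funext fun v => div_eq_mul_inv _ _
  rw [h]
  exact h1.fun_mul (h2.fun_inv (det_firstForm_ne_zero (hx.immersion u hu)))

/-- The logarithmic derivative of the Gaussian curvature. -/
theorem pd_gaussCurvature (hU : IsOpen U) (hx : IsHypersurface 3 U x)
    (hξ : IsEuclideanNormalization U x ξ) (hu : u ∈ U) (hH : (secondForm x ξ u).det ≠ 0)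
    (k : Fin n) :
    pd k (gaussCurvature x ξ) u = gaussCurvature x ξ u *
      ∑ i, ∑ j, (secondForm x ξ u)⁻¹ j i * (pd k (fun v => secondForm x ξ v i j) u +
        2 * inner ℝ (pd k (pd j x) u) (pd i ξ u)) := by
  have hg := det_firstForm_ne_zero (hx.immersion u hu)
  have hdg : ∀ i j, DifferentiableAt ℝ (fun v => firstForm x v i j) u := fun i j =>
    (pd_firstForm hU hx hu i j i).1
  -- Differentiating `K det g = det h` avoids the quotient rule.
  have hprod : pd k (fun v => gaussCurvature x ξ v * (firstForm x v).det) u =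
      pd k (fun v => (secondForm x ξ v).det) u :=
    pd_congr_on hU (fun v hv => div_mul_cancel₀ _ (det_firstForm_ne_zero (hx.immersion v hv))) hu k
  rw [pd_mul (differentiableAt_gaussCurvature hU hx hξ hu) (hasFDerivAt_det hdg).differentiableAt,
    pd_det hdg hg,
    pd_det (fun i j => differentiableAt_secondForm hU hx hξ hu i j) hH] at hprod
  have hgsum : ∑ i, ∑ j, (firstForm x u)⁻¹ j i * pd k (fun v => firstForm x v i j) u =
      -(2 * ∑ i, ∑ j, (secondForm x ξ u)⁻¹ j i * inner ℝ (pd k (pd j x) u) (pd i ξ u)) := by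
    rw [sum_inv_secondForm_mul_inner hU hx hξ hu hH hg]
    simp_rw [(pd_firstForm hU hx hu _ _ k).2, mul_add, Finset.sum_add_distrib]
    have : ∑ i, ∑ j, (firstForm x u)⁻¹ j i * inner ℝ (pd k (pd i x) u) (pd j x u) =
        ∑ i, ∑ j, (firstForm x u)⁻¹ j i * inner ℝ (pd k (pd j x) u) (pd i x u) := by
      rw [Finset.sum_comm]
      exact Finset.sum_congr rfl fun i _ => Finset.sum_congr rfl fun j _ => by
        rw [(firstForm_isSymm (x := x) (u := u)).inv.apply]
    rw [this]
    ring
  have hHK : (secondForm x ξ u).det = gaussCurvature x ξ u * (firstForm x u).det :=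
    (div_mul_cancel₀ _ hg).symm
  rw [hgsum, hHK] at hprod
  simp_rw [mul_add, Finset.sum_add_distrib, mul_left_comm _ (2 : ℝ), ← Finset.mul_sum]
  refine mul_right_cancel₀ hg ?_
  linear_combination hprod

end Structure

end RelGeom

namespace RelGeom

/-! ### The sum and the difference of the two 1-forms. -/

section Main

variable {n : ℕ} {U : Set (Param n)} {x ξ y : Param n → Ambient n} {u : Param n}

theorem secondForm_eq_smul (hx : IsHypersurface 3 U x) (hξ : IsEuclideanNormalization U x ξ)
    (hy : IsRelativeNormalization 1 U x y) (hu : u ∈ U) :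
    secondForm x ξ u = supportFunction ξ y u • relMetric x y u := by
  have h := (hx.immersion u hu)
  rw [relMetric_eq h (hξ.norm_eq_one u hu) (hξ.normal u hu) (hy.transversal u hu), smul_smul,
    mul_inv_cancel₀ (supportFunction_ne_zero h (hξ.norm_eq_one u hu) (hξ.normal u hu)
      (hy.transversal u hu)), one_smul]

theorem supportFunction_ne_zero_of_mem (hx : IsHypersurface 3 U x)
    (hξ : IsEuclideanNormalization U x ξ) (hy : IsRelativeNormalization 1 U x y) (hu : u ∈ U) :
    supportFunction ξ y u ≠ 0 :=
  supportFunction_ne_zero (hx.immersion u hu) (hξ.norm_eq_one u hu) (hξ.normal u hu)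
    (hy.transversal u hu)

theorem differentiableAt_supportFunction (hU : IsOpen U) (hx : IsHypersurface 3 U x)
    (hξ : IsEuclideanNormalization U x ξ) (hy : IsRelativeNormalization 1 U x y) (hu : u ∈ U) :
    DifferentiableAt ℝ (supportFunction ξ y) u :=
  DifferentiableAt.inner ℝ
    (((hξ.contDiffOn hU hx).contDiffAt (hU.mem_nhds hu)).differentiableAt two_ne_zero)
    ((hy.contDiffOn.contDiffAt (hU.mem_nhds hu)).differentiableAt one_ne_zero)

theorem differentiableAt_relMetric (hU : IsOpen U) (hx : IsHypersurface 3 U x)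
    (hξ : IsEuclideanNormalization U x ξ) (hy : IsRelativeNormalization 1 U x y) (hu : u ∈ U)
    (i j : Fin n) : DifferentiableAt ℝ (fun v => relMetric x y v i j) u := by
  refine DifferentiableAt.congr_of_eventuallyEq
    (f := fun v => (supportFunction ξ y v)⁻¹ * secondForm x ξ v i j)
    (((differentiableAt_supportFunction hU hx hξ hy hu).inv
      (supportFunction_ne_zero_of_mem hx hξ hy hu)).mul
      (differentiableAt_secondForm hU hx hξ hu i j)) ?_
  filter_upwards [hU.mem_nhds hu] with v hv
  rw [relMetric_eq (hx.immersion v hv) (hξ.norm_eq_one v hv) (hξ.normal v hv)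
    (hy.transversal v hv)]
  rfl

theorem pd_secondForm_eq (hU : IsOpen U) (hx : IsHypersurface 3 U x)
    (hξ : IsEuclideanNormalization U x ξ) (hy : IsRelativeNormalization 1 U x y) (hu : u ∈ U)
    (i j k : Fin n) :
    pd k (fun v => secondForm x ξ v i j) u =
      pd k (supportFunction ξ y) u * relMetric x y u i j +
        supportFunction ξ y u * pd k (fun v => relMetric x y v i j) u := by
  rw [← pd_mul (differentiableAt_supportFunction hU hx hξ hy hu)
    (differentiableAt_relMetric hU hx hξ hy hu i j)]
  refine pd_congr_on hU (fun v hv => ?_) hu k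
  rw [secondForm_eq_smul hx hξ hy hv]
  rfl

theorem pairDiff_beltrami (G : Param n → Matrix (Fin n) (Fin n) ℝ) (a b : Param n → Ambient n)
    (k : Fin n) :
    pairDiff (beltrami G a) b u (EuclideanSpace.single k 1) =
      ∑ i, ∑ j, (G u)⁻¹ i j * (inner ℝ (pd j (pd i a) u) (pd k b u) -
        ∑ m, christoffel G m i j u * inner ℝ (pd m a u) (pd k b u)) := by
  change inner ℝ (beltrami G a u) (pd k b u) = _
  simp only [beltrami, sum_inner, real_inner_smul_left, inner_sub_left]

theorem relMetric_isSymm (hU : IsOpen U) (hx : IsHypersurface 3 U x) (hu : u ∈ U) :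
    (relMetric x y u).IsSymm := by
  ext i j
  change inner ℝ _ (pd i (pd j x) u) = inner ℝ _ (pd j (pd i x) u)
  rw [pd_pd_comm hU hx hu]

theorem det_relMetric_ne_zero (hx : IsHypersurface 3 U x)
    (hξ : IsEuclideanNormalization U x ξ) (hy : IsRelativeNormalization 1 U x y) (hu : u ∈ U)
    (hH : (secondForm x ξ u).det ≠ 0) : (relMetric x y u).det ≠ 0 := by
  rw [secondForm_eq_smul hx hξ hy hu, Matrix.det_smul] at hH
  exact right_ne_zero_of_mul hH

theorem sum_christoffel_mul_secondForm (hx : IsHypersurface 3 U x)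
    (hξ : IsEuclideanNormalization U x ξ) (hy : IsRelativeNormalization 1 U x y) (hu : u ∈ U)
    (hH : (secondForm x ξ u).det ≠ 0) (i j k : Fin n) :
    ∑ m, christoffel (relMetric x y) m i j u * secondForm x ξ u k m =
      1 / 2 * supportFunction ξ y u * (pd i (fun v => relMetric x y v j k) u +
        pd j (fun v => relMetric x y v i k) u - pd k (fun v => relMetric x y v i j) u) := by
  have h := sum_christoffel_mul (det_relMetric_ne_zero hx hξ hy hu hH)
    (fun l => pd i (fun v => relMetric x y v j l) u + pd j (fun v => relMetric x y v i l) u -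
      pd l (fun v => relMetric x y v i j) u) k
  rw [mul_comm (1 / 2 : ℝ), mul_assoc, ← h, Finset.mul_sum, secondForm_eq_smul hx hξ hy hu]
  refine Finset.sum_congr rfl fun m _ => ?_
  rw [Matrix.smul_apply, smul_eq_mul]
  unfold christoffel
  ring

theorem pairDiff_beltrami_position (hU : IsOpen U) (hx : IsHypersurface 3 U x)
    (hξ : IsEuclideanNormalization U x ξ) (hu : u ∈ U)
    (G : Param n → Matrix (Fin n) (Fin n) ℝ) (k : Fin n) :
    pairDiff (beltrami G x) ξ u (EuclideanSpace.single k 1) =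
      ∑ i, ∑ j, (G u)⁻¹ i j * (inner ℝ (pd j (pd i x) u) (pd k ξ u) +
        ∑ m, christoffel G m i j u * secondForm x ξ u k m) := by
  rw [pairDiff_beltrami]
  refine Finset.sum_congr rfl fun i _ => Finset.sum_congr rfl fun j _ => ?_
  rw [sub_eq_add_neg, ← Finset.sum_neg_distrib]
  congr 2
  refine Finset.sum_congr rfl fun m _ => ?_
  rw [real_inner_comm, inner_pd_pd hU hx hξ hu, (secondForm_isSymm hU hx hu).apply]
  ring

theorem pairDiff_beltrami_normal (hU : IsOpen U) (hx : IsHypersurface 3 U x)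
    (hξ : IsEuclideanNormalization U x ξ) (hu : u ∈ U)
    (G : Param n → Matrix (Fin n) (Fin n) ℝ) (k : Fin n) :
    pairDiff (beltrami G ξ) x u (EuclideanSpace.single k 1) =
      ∑ i, ∑ j, (G u)⁻¹ i j * (-pd j (fun v => secondForm x ξ v k i) u -
        inner ℝ (pd j (pd k x) u) (pd i ξ u) +
        ∑ m, christoffel G m i j u * secondForm x ξ u k m) := by
  rw [pairDiff_beltrami]
  refine Finset.sum_congr rfl fun i _ => Finset.sum_congr rfl fun j _ => ?_
  rw [sub_eq_add_neg, ← Finset.sum_neg_distrib, inner_pd_pd_normal hU hx hξ hu]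
  congr 2
  refine Finset.sum_congr rfl fun m _ => ?_
  rw [inner_pd_pd hU hx hξ hu]
  ring

theorem pd_relMetric_symm (hU : IsOpen U) (hx : IsHypersurface 3 U x) (hu : u ∈ U)
    (i j k : Fin n) :
    pd k (fun v => relMetric x y v i j) u = pd k (fun v => relMetric x y v j i) u :=
  pd_congr_on hU (fun _ hv => (relMetric_isSymm hU hx hv).apply j i) hu k

theorem pairDiff_add_pairDiff (hU : IsOpen U) (hx : IsHypersurface 3 U x)
    (hξ : IsEuclideanNormalization U x ξ) (hy : IsRelativeNormalization 1 U x y) (hu : u ∈ U)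
    (hH : (secondForm x ξ u).det ≠ 0) (k : Fin n) :
    pairDiff (beltrami (relMetric x y) x) ξ u (EuclideanSpace.single k 1) +
      pairDiff (beltrami (relMetric x y) ξ) x u (EuclideanSpace.single k 1) =
        (n - 2) * pd k (supportFunction ξ y) u := by
  rw [pairDiff_beltrami_position hU hx hξ hu, pairDiff_beltrami_normal hU hx hξ hu]
  have h := sum_inv_mul_trace_part (det_relMetric_ne_zero hx hξ hy hu hH)
    (relMetric_isSymm hU hx hu) (fun k => pd k (supportFunction ξ y) u) k
  rw [Fintype.card_fin] at h
  rw [← h, ← Finset.sum_add_distrib]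
  refine Finset.sum_congr rfl fun i _ => ?_
  rw [← Finset.sum_add_distrib]
  refine Finset.sum_congr rfl fun j _ => ?_
  rw [← mul_add, sum_christoffel_mul_secondForm hx hξ hy hu hH]
  congr 1
  have e1 := pd_secondForm hU hx hξ hu i j k
  have e2 := pd_secondForm hU hx hξ hu k j i
  -- Symmetry of third derivatives makes the terms `⟨ξ, x_{/ijk}⟩` of `e1` and `e2` cancel in `e2 -
  -- e1`.
  have s1 : pd k (pd j (pd i x)) u = pd i (pd j (pd k x)) u := by
    rw [pd_pd_pd_comm_right hU hx hu k j i, pd_pd_pd_comm_left hU hx hu k i j,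
      pd_pd_pd_comm_right hU hx hu i k j]
  rw [pd_secondForm_eq hU hx hξ hy hu, s1] at e1
  rw [pd_secondForm_eq hU hx hξ hy hu, pd_relMetric_symm hU hx hu,
    (relMetric_isSymm hU hx hu).apply j k] at e2
  have e3 := pd_secondForm_eq hU hx hξ hy hu k i j
  rw [pd_relMetric_symm hU hx hu k i, (relMetric_isSymm hU hx hu).apply i k] at e3
  rw [e3]
  linear_combination e2 - e1

theorem pairDiff_sub_pairDiff (hU : IsOpen U) (hx : IsHypersurface 3 U x)
    (hξ : IsEuclideanNormalization U x ξ) (hy : IsRelativeNormalization 1 U x y) (hu : u ∈ U)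
    (hH : (secondForm x ξ u).det ≠ 0) (k : Fin n) :
    (pairDiff (beltrami (relMetric x y) x) ξ u (EuclideanSpace.single k 1) -
      pairDiff (beltrami (relMetric x y) ξ) x u (EuclideanSpace.single k 1)) *
        gaussCurvature x ξ u = supportFunction ξ y u * pd k (gaussCurvature x ξ) u := by
  rw [pairDiff_beltrami_position hU hx hξ hu, pairDiff_beltrami_normal hU hx hξ hu,
    pd_gaussCurvature hU hx hξ hu hH k, mul_left_comm, mul_comm]
  congr 1
  have hq := supportFunction_ne_zero_of_mem hx hξ hy hu
  have hinv : (relMetric x y u)⁻¹ = supportFunction ξ y u • (secondForm x ξ u)⁻¹ := by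
    refine Matrix.inv_eq_right_inv ?_
    rw [Matrix.mul_smul, ← Matrix.smul_mul, ← secondForm_eq_smul hx hξ hy hu,
      Matrix.mul_nonsing_inv _ (isUnit_iff_ne_zero.2 hH)]
  rw [hinv]
  have hs : ∀ i j, (secondForm x ξ u)⁻¹ i j = (secondForm x ξ u)⁻¹ j i := fun i j =>
    ((secondForm_isSymm hU hx hu).inv.apply i j).symm
  have hswap : ∑ i, ∑ j, (secondForm x ξ u)⁻¹ j i * inner ℝ (pd k (pd j x) u) (pd i ξ u) =
      ∑ i, ∑ j, (secondForm x ξ u)⁻¹ j i * inner ℝ (pd k (pd i x) u) (pd j ξ u) := by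
    rw [Finset.sum_comm]
    exact Finset.sum_congr rfl fun i _ => Finset.sum_congr rfl fun j _ => by rw [hs]
  -- Splitting the doubled term into its two index-swapped halves makes the remaining identity hold
  -- summand by summand.
  have hsum : ∑ i, ∑ j, (secondForm x ξ u)⁻¹ j i *
        (pd k (fun v => secondForm x ξ v i j) u + 2 * inner ℝ (pd k (pd j x) u) (pd i ξ u)) =
      ∑ i, ∑ j, (secondForm x ξ u)⁻¹ j i *
        (pd k (fun v => secondForm x ξ v i j) u + inner ℝ (pd k (pd j x) u) (pd i ξ u) +
          inner ℝ (pd k (pd i x) u) (pd j ξ u)) := by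
    simp only [two_mul, mul_add, Finset.sum_add_distrib]
    rw [hswap]
    ring
  rw [hsum, ← Finset.sum_sub_distrib, Finset.mul_sum]
  refine Finset.sum_congr rfl fun i _ => ?_
  rw [← Finset.sum_sub_distrib, Finset.mul_sum]
  refine Finset.sum_congr rfl fun j _ => ?_
  rw [Matrix.smul_apply, smul_eq_mul, hs i j]
  have e1 := pd_secondForm hU hx hξ hu i j k
  have e2 := pd_secondForm hU hx hξ hu k i j
  have s1 : pd k (pd j (pd i x)) u = pd j (pd i (pd k x)) u := by
    rw [pd_pd_pd_comm_left hU hx hu k j i, pd_pd_pd_comm_right hU hx hu j k i]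
  rw [s1] at e1
  rw [e2, e1, pd_pd_comm hU hx hu i k, pd_pd_comm hU hx hu j k]
  ring

end Main

end RelGeom

theorem mainTheorem6 (n : ℕ) (r s : WithTop ℕ∞) (hs : 1 ≤ s) (hsr : s < r) (hr : 3 ≤ r)
    (U : Set (RelGeom.Param n)) (hU : IsOpen U)
    (x ξ y : RelGeom.Param n → RelGeom.Ambient n)
    (hx : RelGeom.IsHypersurface r U x)
    (hξ : RelGeom.IsEuclideanNormalization U x ξ)
    (hK : ∀ u ∈ U, RelGeom.gaussCurvature x ξ u ≠ 0)
    (hy : RelGeom.IsRelativeNormalization s U x y) :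
    (n = 2 → ∀ u ∈ U,
      RelGeom.pairDiff (RelGeom.beltrami (RelGeom.relMetric x y) x) ξ u +
        RelGeom.pairDiff (RelGeom.beltrami (RelGeom.relMetric x y) ξ) x u = 0) ∧
    (n ≠ 2 → IsPreconnected U →
      ((∀ u ∈ U,
        RelGeom.pairDiff (RelGeom.beltrami (RelGeom.relMetric x y) x) ξ u +
          RelGeom.pairDiff (RelGeom.beltrami (RelGeom.relMetric x y) ξ) x u = 0) ↔
        ∃ c : ℝ, ∀ u ∈ U, RelGeom.supportFunction ξ y u = c)) ∧
    (IsPreconnected U →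
      ((∀ u ∈ U,
        RelGeom.pairDiff (RelGeom.beltrami (RelGeom.relMetric x y) x) ξ u -
          RelGeom.pairDiff (RelGeom.beltrami (RelGeom.relMetric x y) ξ) x u = 0) ↔
        ∃ c : ℝ, ∀ u ∈ U, RelGeom.gaussCurvature x ξ u = c)) := by
  have hx3 : IsHypersurface 3 U x := ⟨hx.contDiffOn.of_le hr, hx.injOn, hx.immersion⟩
  have hy1 : IsRelativeNormalization 1 U x y :=
    ⟨hy.contDiffOn.of_le hs, hy.transversal, hy.pd_mem⟩
  have hH : ∀ u ∈ U, (secondForm x ξ u).det ≠ 0 := fun u hu h =>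
    hK u hu (by rw [gaussCurvature, h, zero_div])
  have hadd : ∀ u ∈ U, pairDiff (beltrami (relMetric x y) x) ξ u +
      pairDiff (beltrami (relMetric x y) ξ) x u = 0 ↔
        ∀ k, ((n : ℝ) - 2) * pd k (supportFunction ξ y) u = 0 := fun u hu => by
    simp only [clm_eq_zero_iff, add_apply, pairDiff_add_pairDiff hU hx3 hξ hy1 hu (hH u hu)]
  have hsub : ∀ u ∈ U, pairDiff (beltrami (relMetric x y) x) ξ u -
      pairDiff (beltrami (relMetric x y) ξ) x u = 0 ↔
        ∀ k, pd k (gaussCurvature x ξ) u = 0 := fun u hu => by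
    rw [clm_eq_zero_iff]
    refine forall_congr' fun k => ?_
    have h := pairDiff_sub_pairDiff hU hx3 hξ hy1 hu (hH u hu) k
    have hq := supportFunction_ne_zero_of_mem hx3 hξ hy1 hu
    rw [sub_apply]
    constructor
    · intro h0
      rw [h0, zero_mul] at h
      exact (mul_eq_zero.1 h.symm).resolve_left hq
    · intro h0
      rw [h0, mul_zero] at h
      exact (mul_eq_zero.1 h).resolve_right (hK u hu)
  refine ⟨fun hn u hu => (hadd u hu).2 fun k => ?_, fun hn hU' => ?_, fun hU' => ?_⟩
  · have : (n : ℝ) = 2 := by exact_mod_cast hn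
    rw [this, sub_self, zero_mul]
  · have hn' : (n : ℝ) - 2 ≠ 0 := sub_ne_zero.2 (by exact_mod_cast hn)
    rw [exists_eq_const_iff_pd_eq_zero hU hU' fun u hu =>
      differentiableAt_supportFunction hU hx3 hξ hy1 hu]
    refine forall₂_congr fun u hu => (hadd u hu).trans (forall_congr' fun k => ?_)
    simp [hn']
  · rw [exists_eq_const_iff_pd_eq_zero hU hU' fun u hu =>
      differentiableAt_gaussCurvature hU hx3 hξ hu]
    exact forall₂_congr hsub
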